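/- Let $R$ be an integral domain with quotient field $K$ and let $\{X_\alpha\}$ be an arbitrary (possibly infinite) set of independent indeterminates over $R$. For a nonzero fractional ideal $I$ of a domain $A$ with quotient field $F$, put $I^{-1}=\{x\in F : xI\subseteq A\}$, $I_v=(I^{-1})^{-1}$, and $I_t=\bigcup J_v$, the union over all nonzero finitely generated fractional ideals $J\subseteq I$; moreover $0_v=0_t=0$. A nonzero fractional ideal $I$ is a $t$-ideal if $I=I_t$, and is $t$-invertible if $(II^{-1})_t=A$; a maximal $t$-ideal is an ideal of $A$ that is maximal among the proper ideals of $A$ that are (nonzero) $t$-ideals. For a polynomial $g\in R[\{X_\alpha\}]$ let $c(g)$ be the ideal of $R$ generated by the coefficients of $g$, and for an ideal $Q$ of $R[\{X_\alpha\}]$ let $c(Q)$ be the ideal of $R$ generated by the coefficients of all polynomials in $Q$. Let $Q$ be an upper to zero in $R[\{X_\alpha\}]$, i.e. a prime ideal with $Q\cap R=0$. Then the following statements are equivalent: 1. $Q$ is a maximal $t$-ideal of $R[\{X_\alpha\}]$; 2. $Q$ is a $t$-invertible $t$-ideal of $R[\{X_\alpha\}]$; 3. $c(Q)_t=R$ and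 $\operatorname{ht}Q=1$. If these equivalent statements hold, then $Q=fK[\{X_\alpha\}]\cap R[\{X_\alpha\}]$ for some $f\in R[\{X_\alpha\}]$ that is irreducible in $K[\{X_\alpha\}]$; $Q$ contains an element $g$ with $c(g)_v=R$; and for every such $f$ and every such $g$ one has $Q=(f,g)_v$. -/

import Mathlib

open scoped nonZeroDivisors

namespace FractionalIdeal

variable {A : Type*} [CommRing A] [IsDomain A] {K : Type*} [Field K] [Algebra A K]
  [IsFractionRing A K]

/-- The `v`-closure (divisorial closure) `(I⁻¹)⁻¹` of a fractional ideal, where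
`I⁻¹ = {x ∈ K | x I ⊆ A}` for `I ≠ 0`. (With Mathlib's `0⁻¹ = 0`, the closure of `0` is `0`.) -/
noncomputable def vClosure (I : FractionalIdeal A⁰ K) : FractionalIdeal A⁰ K := (I⁻¹)⁻¹

theorem vClosure_zero : vClosure (0 : FractionalIdeal A⁰ K) = 0 := by
  simp [vClosure, inv_zero']

theorem inv_ne_zero_of_ne_zero {I : FractionalIdeal A⁰ K} (hI : I ≠ 0) : I⁻¹ ≠ 0 := by
  intro h
  have := bot_lt_mul_inv hI
  rw [h, mul_zero] at this
  exact lt_irrefl _ this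

theorem vClosure_mono {I J : FractionalIdeal A⁰ K} (h : I ≤ J) : vClosure I ≤ vClosure J := by
  by_cases hI : I = 0
  · rw [hI, vClosure_zero]
    exact zero_le _
  · have hJ : J ≠ 0 := by
      rintro rfl
      exact hI (le_zero_iff.mp h)
    exact inv_anti_mono (inv_ne_zero_of_ne_zero hJ) (inv_ne_zero_of_ne_zero hI)
      (inv_anti_mono hI hJ h)

/-- The `t`-closure of a fractional ideal: the union of the `v`-closures of its finitely generated
fractional subideals. (The subideal `0` is allowed and contributes only the element `0`;
see `mem_tClosure_iff`.) -/
noncomputable def tClosure (I : FractionalIdeal A⁰ K) : FractionalIdeal A⁰ K :=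
  ⟨{ carrier := {x | ∃ J : FractionalIdeal A⁰ K, J ≤ I ∧ (J : Submodule A K).FG ∧ x ∈ vClosure J}
     zero_mem' := ⟨0, zero_le I, by rw [coe_zero]; exact Submodule.fg_bot, zero_mem _⟩
     add_mem' := by
       rintro x y ⟨J, hJ, hJf, hx⟩ ⟨J', hJ', hJf', hy⟩
       refine ⟨J ⊔ J', sup_le hJ hJ', ?_, ?_⟩
       · rw [coe_sup]
         exact hJf.sup hJf'
       · exact Submodule.add_mem (vClosure (J ⊔ J') : Submodule A K)
           (vClosure_mono le_sup_left hx) (vClosure_mono le_sup_right hy)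
     smul_mem' := by
       rintro a x ⟨J, hJ, hJf, hx⟩
       exact ⟨J, hJ, hJf, Submodule.smul_mem (vClosure J : Submodule A K) a hx⟩ },
   isFractional_of_le (J := vClosure I) (by
     rintro x ⟨J, hJ, -, hx⟩
     exact vClosure_mono hJ hx)⟩

theorem mem_tClosure {I : FractionalIdeal A⁰ K} {x : K} :
    x ∈ tClosure I ↔
      ∃ J : FractionalIdeal A⁰ K, J ≤ I ∧ (J : Submodule A K).FG ∧ x ∈ vClosure J :=
  Iff.rfl

/-- For nonzero `I`, the `t`-closure is the union of `J_v` over the *nonzero* finitely generated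
subideals `J` of `I`. -/
theorem mem_tClosure_iff {I : FractionalIdeal A⁰ K} (hI : I ≠ 0) {x : K} :
    x ∈ tClosure I ↔
      ∃ J : FractionalIdeal A⁰ K,
        J ≠ 0 ∧ J ≤ I ∧ (J : Submodule A K).FG ∧ x ∈ vClosure J := by
  rw [mem_tClosure]
  refine ⟨?_, fun ⟨J, _, h⟩ => ⟨J, h⟩⟩
  rintro ⟨J, hJ, hJf, hx⟩
  by_cases h0 : J = 0
  · subst h0
    rw [vClosure_zero, mem_zero_iff] at hx
    subst hx
    obtain ⟨y, hy, hy0⟩ : ∃ y ∈ I, y ≠ 0 := by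
      by_contra hne
      push Not at hne
      exact hI (eq_zero_iff.mpr hne)
    refine ⟨spanSingleton A⁰ y, spanSingleton_ne_zero_iff.mpr hy0,
      spanSingleton_le_iff_mem.mpr hy, ?_, zero_mem _⟩
    rw [coe_spanSingleton]
    exact Submodule.fg_span_singleton y
  · exact ⟨J, h0, hJ, hJf, hx⟩

/-- A fractional ideal `I` is `t`-invertible if `(I I⁻¹)_t = A`. -/
def IsTInvertible (I : FractionalIdeal A⁰ K) : Prop := tClosure (I * I⁻¹) = 1

/-- A `t`-ideal is a nonzero fractional ideal `I` with `I_t = I`. -/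
def IsTIdeal (I : FractionalIdeal A⁰ K) : Prop := I ≠ 0 ∧ tClosure I = I

end FractionalIdeal

namespace Ideal

/-- A maximal `t`-ideal of the domain `A` (with fraction field `K`): an ideal which is maximal
among the proper ideals of `A` that are `t`-ideals. -/
def IsMaximalTIdeal {A : Type*} [CommRing A] [IsDomain A] (K : Type*) [Field K] [Algebra A K]
    [IsFractionRing A K] (M : Ideal A) : Prop :=
  Maximal (fun N : Ideal A => N ≠ ⊤ ∧ (N : FractionalIdeal A⁰ K).IsTIdeal) M

end Ideal

namespace MvPolynomial

variable {σ R : Type*} [CommRing R]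

/-- The content `c(p)`: the ideal of `R` generated by the coefficients of the polynomial `p`. -/
def contentIdeal (p : MvPolynomial σ R) : Ideal R :=
  Ideal.span {a | ∃ m, coeff m p = a}

/-- The content `c(Q)` of an ideal `Q` of `R[{X_α}]`: the ideal of `R` generated by the
coefficients of all the polynomials in `Q`. -/
def contentOfIdeal (Q : Ideal (MvPolynomial σ R)) : Ideal R :=
  Ideal.span {a | ∃ p ∈ Q, ∃ m, coeff m p = a}

/-- An upper to zero: a prime ideal `Q` of `R[{X_α}]` with `Q ∩ R = 0`. -/
def IsUpperToZero (Q : Ideal (MvPolynomial σ R)) : Prop :=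
  Q.IsPrime ∧ Q.comap (C : R →+* MvPolynomial σ R) = ⊥

/-- `f ∈ R[{X_α}]` is irreducible in `K[{X_α}]` and `Q = f K[{X_α}] ∩ R[{X_α}]`. -/
def IsIrreducibleGenerator (K : Type*) [Field K] [Algebra R K]
    (Q : Ideal (MvPolynomial σ R)) (f : MvPolynomial σ R) : Prop :=
  Irreducible (map (algebraMap R K) f) ∧
    Q = (Ideal.span {map (algebraMap R K) f}).comap (map (algebraMap R K))

end MvPolynomial

/-!
# Uppers to zero that are maximal `t`-ideals

Write `D = R[{X_α}]`. Everything rests on one fact about a polynomial `g` with `c(g)_v = R`: by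
McCoy's theorem over `R / aR`, such a `g` is a nonzerodivisor modulo every nonzero constant `a`
(`C_dvd_of_C_dvd_mul`). So a fraction `u` with `ua, ug ∈ D` already lies in `D`, that is
`(a, g)_v = D` (`dvd_of_dvd_mul_C_of_dvd_mul`). Membership in the `v`-closure of an integral ideal is
phrased as divisibility in the domain (`algebraMap_mem_vClosure_iff`), and a fraction `u` as a pair
`r, s` with `u = r / s`.

* Maximal `t`-ideal implies `c(Q)_t = R` and height one. If `c(Q)_t ≠ R`, the polynomials with
  coefficients in `c(Q)_t` form a proper `t`-ideal strictly larger than `Q`. So `c(Q)_t = R`, and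
  since the contents of the members of `Q` form a directed family, some `g ∈ Q` has `c(g)_v = R`. If
  `f, h ∈ Q` were coprime over `K`, a fraction carrying `f, h, g` into `D` would have only a constant
  denominator, hence lie in `D`, and `Q_t` would be `D`. So any member of `Q` that is prime over `K`
  divides, over `K`, every other one, and `Q = f K[{X_α}] ∩ D`, which has height one.
* Height one and `c(Q)_t = R` imply `t`-invertibility. Again `Q = f K[{X_α}] ∩ D` with `f`
  irreducible over `K`, and there is `g ∈ Q` with `c(g)_v = R`. A fraction carrying `f, g` into `D`
  carries all of `Q` there, so `(f, g)_v = Q_v`. Conversely `ag ∈ fD` for some nonzero constant `a`,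
  so `a / f` carries `f` and `g` into `D`, which confines `(f, g)_v` to `f K[{X_α}] ∩ D = Q`. Now
  `a / f ∈ Q⁻¹` shows that `Q Q⁻¹` contains `a` and `g`, and `(a, g)_v = D`.
* A `t`-invertible prime `t`-ideal of any domain is a maximal `t`-ideal
  (`Ideal.IsPrime.isMaximalTIdeal_of_isTInvertible`).
-/

/-! ### Divisorial closures of integral ideals by divisibility -/

namespace FractionalIdeal

variable {A : Type*} [CommRing A] {L : Type*} [Field L] [Algebra A L]

theorem eq_one_of_le_one_of_one_mem {I : FractionalIdeal A⁰ L} (hI : I ≤ 1) (h : (1 : L) ∈ I) :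
    I = 1 :=
  le_antisymm hI (one_le.mpr h)

/-- The factors in `I` of generators of a finitely generated submodule of `I * J` may be taken from
one finitely generated submodule of `I`. -/
theorem exists_fg_le_mul [IsFractionRing A L] {I J N : FractionalIdeal A⁰ L} (hN : N ≤ I * J)
    (hfg : (N : Submodule A L).FG) :
    ∃ B : FractionalIdeal A⁰ L, B ≤ I ∧ (B : Submodule A L).FG ∧ N ≤ B * J := by
  classical
  obtain ⟨S, hS⟩ := hfg
  have step : ∀ T : Finset L, (∀ x ∈ T, x ∈ I * J) →
      ∃ B : FractionalIdeal A⁰ L, B ≤ I ∧ (B : Submodule A L).FG ∧ ∀ x ∈ T, x ∈ B * J := by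
    intro T
    induction T using Finset.induction_on with
    | empty => exact fun _ => ⟨0, zero_le _, by rw [coe_zero]; exact Submodule.fg_bot, by simp⟩
    | insert a T _ ih =>
      intro h
      obtain ⟨B, hBI, hB, hBT⟩ := ih fun x hx => h x (Finset.mem_insert_of_mem hx)
      obtain ⟨U, V, hU, hV, ha⟩ :=
        mem_span_mul_finite_of_mem_mul (h a (Finset.mem_insert_self a T))
      have hUfg : (Submodule.span A (U : Set L)).FG := ⟨U, rfl⟩
      let B' : FractionalIdeal A⁰ L := ⟨Submodule.span A (U : Set L), isFractional_of_fg hUfg⟩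
      have hB'I : B' ≤ I := Submodule.span_le.mpr hU
      have haB' : a ∈ B' * J := by
        rw [← mem_coe, coe_mul]
        refine Submodule.span_le.mpr ?_ ha
        rintro _ ⟨u, hu, v, hv, rfl⟩
        exact Submodule.mul_mem_mul (Submodule.subset_span hu) (hV hv)
      refine ⟨B ⊔ B', sup_le hBI hB'I, ?_, ?_⟩
      · rw [coe_sup]
        exact hB.sup hUfg
      · intro x hx
        rcases Finset.mem_insert.mp hx with rfl | hx
        · exact mul_le_mul_left le_sup_right J haB'
        · exact mul_le_mul_left le_sup_left J (hBT x hx)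
  obtain ⟨B, hBI, hB, hBS⟩ := step S fun x hx => hN (by
    rw [← mem_coe, ← hS]
    exact Submodule.subset_span hx)
  refine ⟨B, hBI, hB, ?_⟩
  rw [← coe_le_coe, ← hS]
  exact Submodule.span_le.mpr hBS

variable [IsDomain A] [IsFractionRing A L]

theorem le_vClosure (I : FractionalIdeal A⁰ L) : I ≤ vClosure I := by
  by_cases hI : I = 0
  · simp [hI]
  · intro x hx
    rw [vClosure, mem_inv_iff (inv_ne_zero_of_ne_zero hI)]
    intro y hy
    rw [mul_comm]
    exact (mem_inv_iff hI).mp hy x hx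

theorem vClosure_one : vClosure (1 : FractionalIdeal A⁰ L) = 1 := by
  simp [vClosure]

theorem le_tClosure (I : FractionalIdeal A⁰ L) : I ≤ tClosure I := fun x hx =>
  mem_tClosure.mpr ⟨spanSingleton A⁰ x, spanSingleton_le_iff_mem.mpr hx, by
    rw [coe_spanSingleton]
    exact Submodule.fg_span_singleton x, le_vClosure _ (mem_spanSingleton_self _ x)⟩

theorem tClosure_le_vClosure (I : FractionalIdeal A⁰ L) : tClosure I ≤ vClosure I := by
  rintro x ⟨J, hJ, -, hx⟩
  exact vClosure_mono hJ hx

theorem vClosure_le_one {I : FractionalIdeal A⁰ L} (hI : I ≤ 1) : vClosure I ≤ 1 :=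
  (vClosure_mono hI).trans vClosure_one.le

theorem tClosure_le_one {I : FractionalIdeal A⁰ L} (hI : I ≤ 1) : tClosure I ≤ 1 :=
  (tClosure_le_vClosure I).trans (vClosure_le_one hI)

/-- Membership in the `v`-closure of a nonzero integral ideal, as divisibility in the domain: a
fraction `r / s` carries `J` into `A` if and only if `s` divides every element of `r J`. -/
theorem algebraMap_mem_vClosure_iff {J : Ideal A} (hJ : J ≠ ⊥) {x : A} :
    algebraMap A L x ∈ vClosure (J : FractionalIdeal A⁰ L) ↔
      ∀ r s : A, s ≠ 0 → (∀ j ∈ J, s ∣ r * j) → s ∣ r * x := by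
  have hJ0 : (J : FractionalIdeal A⁰ L) ≠ 0 := coeIdeal_ne_zero.mpr hJ
  have key : ∀ r s y : A, s ≠ 0 → ((algebraMap A L r / algebraMap A L s) * algebraMap A L y ∈
      (1 : FractionalIdeal A⁰ L) ↔ s ∣ r * y) := by
    intro r s y hs
    have hs' : algebraMap A L s ≠ 0 := by simpa using hs
    rw [mem_one_iff]
    constructor
    · rintro ⟨z, hz⟩
      refine ⟨z, IsFractionRing.injective A L ?_⟩
      rw [map_mul, map_mul, hz]
      field_simp
    · rintro ⟨z, hz⟩
      refine ⟨z, ?_⟩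
      have := congrArg (algebraMap A L) hz
      rw [map_mul, map_mul] at this
      field_simp
      rw [this, mul_comm]
  rw [vClosure, mem_inv_iff (inv_ne_zero_of_ne_zero hJ0)]
  constructor
  · intro h r s hs hrs
    rw [← key r s x hs, mul_comm]
    refine h _ ((mem_inv_iff hJ0).mpr ?_)
    rintro y hy
    obtain ⟨j, hj, rfl⟩ := (mem_coeIdeal A⁰).mp hy
    exact (key r s j hs).mpr (hrs j hj)
  · intro h y hy
    obtain ⟨r, s, hs, rfl⟩ := IsFractionRing.div_surjective (A := A) y
    have hs0 : s ≠ 0 := nonZeroDivisors.ne_zero hs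
    rw [mul_comm, key r s x hs0]
    refine h r s hs0 fun j hj => (key r s j hs0).mp ?_
    exact (mem_inv_iff hJ0).mp hy _ (mem_coeIdeal_of_mem A⁰ hj)

/-- `J_v = A` says that only the elements of `A` carry `J` into `A`. -/
theorem vClosure_coeIdeal_eq_one_iff {J : Ideal A} (hJ : J ≠ ⊥) :
    vClosure (J : FractionalIdeal A⁰ L) = 1 ↔
      ∀ r s : A, s ≠ 0 → (∀ j ∈ J, s ∣ r * j) → s ∣ r := by
  have h1 := algebraMap_mem_vClosure_iff (L := L) hJ (x := 1)
  simp only [map_one, mul_one] at h1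
  rw [← h1]
  exact ⟨fun h => h ▸ one_mem_one A⁰,
    eq_one_of_le_one_of_one_mem (vClosure_le_one coeIdeal_le_one)⟩

/-- For an integral ideal, the `t`-closure is obtained from its finitely generated subideals. -/
theorem mem_tClosure_coeIdeal_iff {I : Ideal A} (hI : I ≠ ⊥) {x : L} :
    x ∈ tClosure (I : FractionalIdeal A⁰ L) ↔
      ∃ J : Ideal A, J ≠ ⊥ ∧ J ≤ I ∧ J.FG ∧ x ∈ vClosure (J : FractionalIdeal A⁰ L) := by
  rw [mem_tClosure_iff (coeIdeal_ne_zero.mpr hI)]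
  constructor
  · rintro ⟨J, hJ0, hJI, hJ, hx⟩
    obtain ⟨J, rfl⟩ := le_one_iff_exists_coeIdeal.mp (hJI.trans coeIdeal_le_one)
    exact ⟨J, coeIdeal_ne_zero.mp hJ0, (coeIdeal_le_coeIdeal L).mp hJI,
      (coeIdeal_fg A⁰ (IsFractionRing.injective A L) J).mp hJ, hx⟩
  · rintro ⟨J, hJ0, hJI, hJ, hx⟩
    exact ⟨J, coeIdeal_ne_zero.mpr hJ0, (coeIdeal_le_coeIdeal L).mpr hJI,
      (coeIdeal_fg A⁰ (IsFractionRing.injective A L) J).mpr hJ, hx⟩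

/-- A proper ideal that is a `t`-ideal contains no finitely generated ideal with `v`-closure `A`. -/
theorem IsTIdeal.eq_top {I J : Ideal A} (hI : (I : FractionalIdeal A⁰ L).IsTIdeal) (hJI : J ≤ I)
    (hJ : J.FG) (hv : vClosure (J : FractionalIdeal A⁰ L) = 1) : I = ⊤ := by
  have h1 : (1 : L) ∈ (I : FractionalIdeal A⁰ L) := by
    rw [← hI.2]
    exact mem_tClosure.mpr ⟨J, (coeIdeal_le_coeIdeal L).mpr hJI,
      (coeIdeal_fg A⁰ (IsFractionRing.injective A L) J).mpr hJ, hv ▸ one_mem_one A⁰⟩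
  rw [Ideal.eq_top_iff_one]
  obtain ⟨y, hy, hy1⟩ := (mem_coeIdeal A⁰).mp h1
  rw [← map_one (algebraMap A L)] at hy1
  rwa [← IsFractionRing.injective A L hy1]

end FractionalIdeal

namespace Ideal

open FractionalIdeal

variable {A : Type*} [CommRing A] [IsDomain A] {L : Type*} [Field L] [Algebra A L]
  [IsFractionRing A L]

/-- A `t`-invertible prime `t`-ideal `Q` is a maximal `t`-ideal. If `B ⊆ Q` is finitely generated
with `(B Q⁻¹)_v = A` and `a ∉ Q`, then `(B + aA)⁻¹ = A`: an element `u` of it lies in `Q⁻¹`, then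
`uQ ⊆ Q` because `Q` is prime, so `u Q Q⁻¹ ⊆ A` and `u ∈ A`. -/
theorem IsPrime.isMaximalTIdeal_of_isTInvertible {Q : Ideal A} (hQ : Q.IsPrime)
    (ht : (Q : FractionalIdeal A⁰ L).IsTIdeal) (hinv : (Q : FractionalIdeal A⁰ L).IsTInvertible) :
    Q.IsMaximalTIdeal L := by
  refine ⟨⟨hQ.ne_top, ht⟩, fun M ⟨hM, hMt⟩ hQM => ?_⟩
  by_contra hMQ
  obtain ⟨a, haM, haQ⟩ := SetLike.not_le_iff_exists.mp hMQ
  have ha0 : a ≠ 0 := fun h => haQ (h ▸ Q.zero_mem)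
  set q : FractionalIdeal A⁰ L := (Q : FractionalIdeal A⁰ L) with hq
  have hq0 : q ≠ 0 := ht.1
  have h1 : (1 : L) ∈ tClosure (q * q⁻¹) := by
    have : tClosure (q * q⁻¹) = 1 := hinv
    exact this ▸ one_mem_one A⁰
  have hqq0 : q * q⁻¹ ≠ 0 := (bot_lt_mul_inv hq0).ne'
  obtain ⟨N, hN0, hNle, hNfg, hN1⟩ := (mem_tClosure_iff hqq0).mp h1
  -- every element carrying `N` into `A` lies in `A`
  have hNinv : ∀ u : L, (∀ y ∈ N, u * y ∈ (1 : FractionalIdeal A⁰ L)) →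
      u ∈ (1 : FractionalIdeal A⁰ L) := by
    intro u hu
    have := (mem_inv_iff (inv_ne_zero_of_ne_zero hN0)).mp hN1 u ((mem_inv_iff hN0).mpr hu)
    rwa [one_mul] at this
  obtain ⟨B, hBq, hBfg, hNB⟩ := exists_fg_le_mul hNle hNfg
  obtain ⟨B, rfl⟩ := le_one_iff_exists_coeIdeal.mp (hBq.trans coeIdeal_le_one)
  have hBQ : B ≤ Q := (coeIdeal_le_coeIdeal L).mp hBq
  have hqinv : ∀ x ∈ q, ∀ y ∈ q⁻¹, y * x ∈ (1 : FractionalIdeal A⁰ L) := fun x hx y hy =>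
    (mem_inv_iff hq0).mp hy x hx
  refine hM (IsTIdeal.eq_top hMt (J := B ⊔ Ideal.span {a})
    (sup_le (hBQ.trans hQM) ((Ideal.span_singleton_le_iff_mem M).mpr haM))
    (Submodule.FG.sup ((coeIdeal_fg A⁰ (IsFractionRing.injective A L) B).mp hBfg)
      (Submodule.fg_span_singleton a)) ?_)
  have hne : B ⊔ Ideal.span {a} ≠ ⊥ := fun h =>
    ha0 (by simpa using (sup_eq_bot_iff.mp h).2)
  refine (vClosure_coeIdeal_eq_one_iff hne).mpr fun r s hs hrs => ?_
  have hs' : algebraMap A L s ≠ 0 := by simpa using hs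
  have hB : ∀ b ∈ B, s ∣ r * b := fun b hb => hrs b (Ideal.mem_sup_left hb)
  have hra : s ∣ r * a := hrs a (Ideal.mem_sup_right (Ideal.mem_span_singleton_self a))
  set u : L := algebraMap A L r / algebraMap A L s with hu
  have hus : ∀ y z : A, r * y = s * z → u * algebraMap A L y = algebraMap A L z := by
    intro y z h
    have := congrArg (algebraMap A L) h
    rw [map_mul, map_mul] at this
    rw [hu]
    field_simp
    rw [this]
  -- `u B ⊆ A` forces `u Q ⊆ A`
  have huQ : ∀ x ∈ Q, s ∣ r * x := by
    intro x hx
    have hxq : algebraMap A L x ∈ q := mem_coeIdeal_of_mem A⁰ hx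
    have : u * algebraMap A L x ∈ (1 : FractionalIdeal A⁰ L) := by
      refine hNinv _ fun y hy => ?_
      refine FractionalIdeal.mul_induction_on (hNB hy) ?_ ?_
      · intro i hi j hj
        obtain ⟨b, hb, rfl⟩ := (mem_coeIdeal A⁰).mp hi
        obtain ⟨z, hz⟩ := hB b hb
        obtain ⟨w, hw⟩ := (mem_one_iff A⁰).mp (hqinv _ hxq j hj)
        refine (mem_one_iff A⁰).mpr ⟨z * w, ?_⟩
        rw [map_mul, hw, ← hus b z hz]
        ring
      · intro y z hy hz
        rw [mul_add]
        exact Submodule.add_mem (1 : FractionalIdeal A⁰ L).coeToSubmodule hy hz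
    obtain ⟨z, hz⟩ := (mem_one_iff A⁰).mp this
    refine ⟨z, IsFractionRing.injective A L ?_⟩
    rw [map_mul, map_mul, hz, hu]
    field_simp
  -- since `u a ∈ A` and `a ∉ Q`, even `u Q ⊆ Q`
  have huQQ : ∀ x ∈ q, u * x ∈ q := by
    intro y hy
    obtain ⟨x, hx, rfl⟩ := (mem_coeIdeal A⁰).mp hy
    obtain ⟨z, hz⟩ := huQ x hx
    obtain ⟨w, hw⟩ := hra
    rw [hus x z hz]
    refine mem_coeIdeal_of_mem A⁰ ((hQ.mem_or_mem (?_ : z * a ∈ Q)).resolve_right haQ)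
    have : z * a = w * x := mul_left_cancel₀ hs (by linear_combination -a * hz + x * hw)
    rw [this]
    exact Q.mul_mem_left w hx
  have hu1 : u ∈ (1 : FractionalIdeal A⁰ L) := by
    refine hNinv u fun y hy => ?_
    refine FractionalIdeal.mul_induction_on (hNle hy) ?_ ?_
    · intro i hi j hj
      rw [← mul_assoc, mul_comm]
      exact hqinv _ (huQQ i hi) j hj
    · intro y z hy hz
      rw [mul_add]
      exact Submodule.add_mem (1 : FractionalIdeal A⁰ L).coeToSubmodule hy hz
  obtain ⟨z, hz⟩ := (mem_one_iff A⁰).mp hu1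
  refine ⟨z, IsFractionRing.injective A L ?_⟩
  rw [map_mul, hz, hu]
  field_simp

end Ideal

/-! ### Zero divisors and content in polynomial rings -/

namespace MvPolynomial

section Content

variable {σ R : Type*} [CommRing R]

/-- McCoy's theorem: a zero divisor of `R[{X_α}]` is killed by a nonzero constant. A nonzero `w`
with `g w = 0` and the fewest terms is killed by every coefficient of `g`: otherwise some coefficient
`a` of `g` with `a w ≠ 0` kills one term of `w`, and `a w` has fewer terms. -/
theorem exists_C_mul_eq_zero_of_mul_eq_zero {g w : MvPolynomial σ R} (hw : w ≠ 0)
    (h : g * w = 0) : ∃ c : R, c ≠ 0 ∧ ∀ m, c * coeff m g = 0 := by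
  classical
  induction hn : w.support.card using Nat.strong_induction_on generalizing w with
  | _ n ih =>
  by_cases hall : ∀ m, C (coeff m g) * w = 0
  · obtain ⟨b, hb⟩ := ne_zero_iff.mp hw
    refine ⟨coeff b w, hb, fun m => ?_⟩
    have := congrArg (coeff b) (hall m)
    rwa [coeff_C_mul, coeff_zero, mul_comm] at this
  · push Not at hall
    set S := g.support.filter fun m => C (coeff m g) * w ≠ 0 with hS
    have hSne : S.Nonempty := by
      obtain ⟨m, hm⟩ := hall
      refine ⟨m, Finset.mem_filter.mpr ⟨mem_support_iff.mpr fun h0 => hm ?_, hm⟩⟩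
      rw [h0, C_0, zero_mul]
    obtain ⟨a, ha, b, hb, huniq⟩ :=
      UniqueSums.uniqueAdd_of_nonempty hSne (support_nonempty.mpr hw)
    have hab : coeff a g * coeff b w = 0 := by
      have h0 := congrArg (coeff (a + b)) h
      rw [coeff_mul, coeff_zero, Finset.sum_eq_single (a, b)] at h0
      · exact h0
      · rintro ⟨x, y⟩ hxy hne
        by_contra hxy0
        have hx : x ∈ S := by
          refine Finset.mem_filter.mpr ⟨mem_support_iff.mpr (left_ne_zero_of_mul hxy0), fun h1 => ?_⟩
          have := congrArg (coeff y) h1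
          rw [coeff_C_mul, coeff_zero] at this
          exact hxy0 this
        have hy : y ∈ w.support := mem_support_iff.mpr (right_ne_zero_of_mul hxy0)
        obtain ⟨h1, h2⟩ := huniq hx hy (Finset.HasAntidiagonal.mem_antidiagonal.mp hxy)
        exact hne (Prod.ext h1 h2)
      · intro hne
        rw [Finset.HasAntidiagonal.mem_antidiagonal] at hne
        exact absurd rfl hne
    refine ih _ ?_ (Finset.mem_filter.mp ha).2 (by rw [mul_left_comm, h, mul_zero]) rfl
    rw [← hn]
    refine Finset.card_lt_card (Finset.ssubset_iff_of_subset ?_ |>.mpr ⟨b, hb, ?_⟩)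
    · intro m hm
      rw [mem_support_iff, coeff_C_mul] at hm
      exact mem_support_iff.mpr (right_ne_zero_of_mul hm)
    · rw [mem_support_iff, coeff_C_mul, not_not, hab]

/-- If only the multiples of `s` carry all coefficients of `g` into `sR`, then `g` is a
nonzerodivisor modulo `s`. -/
theorem C_dvd_of_C_dvd_mul {g w : MvPolynomial σ R} {s : R}
    (hg : ∀ r, (∀ m, s ∣ r * coeff m g) → s ∣ r) (h : C s ∣ g * w) : C s ∣ w := by
  have hq : ∀ r : R, Ideal.Quotient.mk (Ideal.span {s}) r = 0 ↔ s ∣ r := fun r => by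
    rw [Ideal.Quotient.eq_zero_iff_mem, Ideal.mem_span_singleton]
  rw [C_dvd_iff_map_hom_eq_zero (Ideal.Quotient.mk (Ideal.span {s})) s hq] at h ⊢
  by_contra hw
  rw [map_mul] at h
  obtain ⟨c, hc, hcg⟩ := exists_C_mul_eq_zero_of_mul_eq_zero hw h
  obtain ⟨r, rfl⟩ := Ideal.Quotient.mk_surjective c
  refine hc ((hq r).mpr (hg r fun m => (hq _).mp ?_))
  rw [map_mul, ← coeff_map]
  exact hcg m

theorem coeff_mem_contentIdeal (g : MvPolynomial σ R) (m : σ →₀ ℕ) : coeff m g ∈ contentIdeal g :=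
  Ideal.subset_span ⟨m, rfl⟩

theorem coeff_mem_contentOfIdeal {Q : Ideal (MvPolynomial σ R)} {p : MvPolynomial σ R}
    (hp : p ∈ Q) (m : σ →₀ ℕ) : coeff m p ∈ contentOfIdeal Q :=
  Ideal.subset_span ⟨p, hp, m, rfl⟩

theorem contentIdeal_fg (g : MvPolynomial σ R) : (contentIdeal g).FG := by
  classical
  refine ⟨insert 0 (g.support.image fun m => coeff m g), le_antisymm ?_ ?_⟩
  · refine Submodule.span_le.mpr fun a ha => ?_
    rcases Finset.mem_insert.mp ha with rfl | ha
    · exact zero_mem _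
    · obtain ⟨m, -, rfl⟩ := Finset.mem_image.mp ha
      exact coeff_mem_contentIdeal g m
  · refine Ideal.span_le.mpr ?_
    rintro _ ⟨m, rfl⟩
    by_cases hm : m ∈ g.support
    · exact Submodule.subset_span (Finset.mem_insert_of_mem (Finset.mem_image_of_mem _ hm))
    · rw [notMem_support_iff.mp hm]
      exact zero_mem _

theorem contentIdeal_le_contentOfIdeal {Q : Ideal (MvPolynomial σ R)} {g : MvPolynomial σ R}
    (hg : g ∈ Q) : contentIdeal g ≤ contentOfIdeal Q := by
  refine Ideal.span_le.mpr ?_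
  rintro _ ⟨m, rfl⟩
  exact coeff_mem_contentOfIdeal hg m

theorem contentIdeal_ne_bot {g : MvPolynomial σ R} (hg : g ≠ 0) : contentIdeal g ≠ ⊥ := by
  obtain ⟨m, hm⟩ := ne_zero_iff.mp hg
  exact fun h => hm (by simpa [h] using coeff_mem_contentIdeal g m)

theorem contentOfIdeal_ne_bot {Q : Ideal (MvPolynomial σ R)} (hQ0 : Q ≠ ⊥) :
    contentOfIdeal Q ≠ ⊥ := by
  obtain ⟨p, hp, hp0⟩ := Submodule.exists_mem_ne_zero_of_ne_bot hQ0
  obtain ⟨m, hm⟩ := ne_zero_iff.mp hp0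
  exact fun h => hm (by simpa [h] using coeff_mem_contentOfIdeal hp m)

/-- For `n` large, the coefficients of `g + X_i ^ n h` are those of `g` and those of `h`. -/
theorem exists_mem_contentIdeal_sup_le [Nonempty σ] {Q : Ideal (MvPolynomial σ R)}
    {g h : MvPolynomial σ R} (hg : g ∈ Q) (hh : h ∈ Q) :
    ∃ p ∈ Q, contentIdeal g ⊔ contentIdeal h ≤ contentIdeal p := by
  classical
  obtain ⟨i⟩ := ‹Nonempty σ›
  set e : σ →₀ ℕ := Finsupp.single i (degreeOf i g + 1) with he
  refine ⟨g + monomial e 1 * h, Q.add_mem hg (Q.mul_mem_left _ hh), sup_le ?_ ?_⟩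
  · refine Ideal.span_le.mpr ?_
    rintro _ ⟨m, rfl⟩
    by_cases hm : m ∈ g.support
    · have hle : ¬ e ≤ m := by
        intro hle
        have h1 := hle i
        have h2 := monomial_le_degreeOf i hm
        rw [he, Finsupp.single_eq_same] at h1
        omega
      have := coeff_mem_contentIdeal (g + monomial e 1 * h) m
      rwa [coeff_add, coeff_monomial_mul', if_neg hle, add_zero] at this
    · rw [notMem_support_iff.mp hm]
      exact zero_mem _
  · refine Ideal.span_le.mpr ?_
    rintro _ ⟨m, rfl⟩
    have hm : coeff (e + m) g = 0 := by
      rw [← notMem_support_iff]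
      intro hm
      have h2 := monomial_le_degreeOf i hm
      rw [he, Finsupp.add_apply, Finsupp.single_eq_same] at h2
      omega
    have := coeff_mem_contentIdeal (g + monomial e 1 * h) (e + m)
    rwa [coeff_add, coeff_monomial_mul, hm, zero_add, one_mul] at this

/-- A finitely generated ideal inside `c(Q)` lies in the content of a single member of `Q`. -/
theorem exists_mem_le_contentIdeal [Nonempty σ] {Q : Ideal (MvPolynomial σ R)} {J : Ideal R}
    (hJ : J.FG) (hJQ : J ≤ contentOfIdeal Q) : ∃ g ∈ Q, J ≤ contentIdeal g := by
  classical
  have hmem : ∀ a ∈ contentOfIdeal Q, ∃ g ∈ Q, a ∈ contentIdeal g := by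
    intro a ha
    induction ha using Submodule.span_induction with
    | mem a ha =>
      obtain ⟨p, hp, m, rfl⟩ := ha
      exact ⟨p, hp, coeff_mem_contentIdeal p m⟩
    | zero => exact ⟨0, Q.zero_mem, zero_mem _⟩
    | add a b _ _ iha ihb =>
      obtain ⟨g, hg, hag⟩ := iha
      obtain ⟨h, hh, hbh⟩ := ihb
      obtain ⟨p, hp, hle⟩ := exists_mem_contentIdeal_sup_le hg hh
      exact ⟨p, hp, add_mem (hle (Ideal.mem_sup_left hag)) (hle (Ideal.mem_sup_right hbh))⟩
    | smul c a _ iha =>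
      obtain ⟨g, hg, hag⟩ := iha
      exact ⟨g, hg, Submodule.smul_mem _ c hag⟩
  obtain ⟨S, rfl⟩ := hJ
  induction S using Finset.induction_on with
  | empty => exact ⟨0, Q.zero_mem, by simp⟩
  | insert a S _ ih =>
    rw [Finset.coe_insert, Ideal.span_insert, sup_le_iff] at hJQ
    obtain ⟨g, hg, hSg⟩ := ih hJQ.2
    obtain ⟨h, hh, hah⟩ := hmem a (hJQ.1 (Submodule.mem_span_singleton_self a))
    obtain ⟨p, hp, hle⟩ := exists_mem_contentIdeal_sup_le hh hg
    refine ⟨p, hp, ?_⟩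
    rw [Finset.coe_insert, Ideal.span_insert]
    exact (sup_le_sup ((Submodule.span_singleton_le_iff_mem a _).mpr hah) hSg).trans hle

end Content

section UnitContent

variable {σ R : Type*} [CommRing R] [IsDomain R] {K : Type*} [Field K] [Algebra R K]
  [IsFractionRing R K]

theorem ne_zero_of_vClosure_contentIdeal_eq_one {g : MvPolynomial σ R}
    (hg : (g.contentIdeal : FractionalIdeal R⁰ K).vClosure = 1) : g ≠ 0 := by
  rintro rfl
  have h0 : contentIdeal (0 : MvPolynomial σ R) = ⊥ := by
    refine Ideal.span_eq_bot.mpr ?_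
    rintro _ ⟨m, rfl⟩
    exact coeff_zero m
  rw [h0, FractionalIdeal.coeIdeal_bot, FractionalIdeal.vClosure_zero] at hg
  exact zero_ne_one hg

/-- If `c(g)_v = R` and `a` is a nonzero constant, then `(a, g)_v = R[{X_α}]`: a fraction carrying
both `a` and `g` into `R[{X_α}]` is a polynomial. -/
theorem dvd_of_dvd_mul_C_of_dvd_mul {g : MvPolynomial σ R}
    (hg : (g.contentIdeal : FractionalIdeal R⁰ K).vClosure = 1) {a : R} (ha : a ≠ 0)
    {r s : MvPolynomial σ R} (hs : s ≠ 0) (hra : s ∣ r * C a) (hrg : s ∣ r * g) : s ∣ r := by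
  have hg0 := ne_zero_of_vClosure_contentIdeal_eq_one hg
  have hCa : (C a : MvPolynomial σ R) ≠ 0 := by simpa using ha
  obtain ⟨w, hw⟩ := hra
  obtain ⟨v, hv⟩ := hrg
  have hgw : g * w = C a * v := mul_left_cancel₀ hs (by linear_combination C a * hv - g * hw)
  have hcont := (FractionalIdeal.vClosure_coeIdeal_eq_one_iff (contentIdeal_ne_bot hg0)).mp hg
  obtain ⟨w, rfl⟩ : C a ∣ w := by
    refine C_dvd_of_C_dvd_mul (fun r hr => hcont r a ha fun j hj => ?_) ⟨v, hgw⟩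
    induction hj using Submodule.span_induction with
    | mem b hb =>
      obtain ⟨m, rfl⟩ := hb
      exact hr m
    | zero => simp
    | add b c _ _ hb hc =>
      rw [mul_add]
      exact dvd_add hb hc
    | smul c b _ hb =>
      rw [smul_eq_mul, mul_left_comm]
      exact hb.mul_left c
  exact ⟨w, mul_right_cancel₀ hCa (by linear_combination hw)⟩

end UnitContent

/-! ### Uppers to zero and the polynomial ring over the quotient field -/

section Upper

variable {σ R : Type*} [CommRing R]

theorem IsUpperToZero.C_notMem {Q : Ideal (MvPolynomial σ R)} (hQ : IsUpperToZero Q) {a : R}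
    (ha : a ≠ 0) : C a ∉ Q := fun h => ha (by
  have : a ∈ Q.comap (C : R →+* MvPolynomial σ R) := h
  rwa [hQ.2, Ideal.mem_bot] at this)

theorem IsUpperToZero.nonempty {Q : Ideal (MvPolynomial σ R)} (hQ : IsUpperToZero Q)
    (hQ0 : Q ≠ ⊥) : Nonempty σ := by
  by_contra hσ
  rw [not_nonempty_iff] at hσ
  obtain ⟨p, hp, hp0⟩ := Submodule.exists_mem_ne_zero_of_ne_bot hQ0
  obtain ⟨a, rfl⟩ := C_surjective (R := R) σ p
  exact hQ.C_notMem (fun h => hp0 (by rw [h, C_0])) hp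

variable {K : Type*} [Field K] [Algebra R K]

theorem IsIrreducibleGenerator.mem_iff {Q : Ideal (MvPolynomial σ R)} {f h : MvPolynomial σ R}
    (hf : IsIrreducibleGenerator K Q f) :
    h ∈ Q ↔ map (algebraMap R K) f ∣ map (algebraMap R K) h := by
  rw [hf.2, Ideal.mem_comap, Ideal.mem_span_singleton]

theorem IsIrreducibleGenerator.mem {Q : Ideal (MvPolynomial σ R)} {f : MvPolynomial σ R}
    (hf : IsIrreducibleGenerator K Q f) : f ∈ Q :=
  hf.mem_iff.mpr dvd_rfl

theorem IsIrreducibleGenerator.ne_zero {Q : Ideal (MvPolynomial σ R)} {f : MvPolynomial σ R}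
    (hf : IsIrreducibleGenerator K Q f) : f ≠ 0 := by
  rintro rfl
  exact hf.1.ne_zero (map_zero _)

variable [IsFractionRing R K]

variable (K) in
theorem map_algebraMap_injective :
    Function.Injective (map (algebraMap R K) : MvPolynomial σ R →+* MvPolynomial σ K) :=
  map_injective _ (IsFractionRing.injective R K)

theorem isUnit_map_C {a : R} (ha : a ≠ 0) :
    IsUnit (map (algebraMap R K) (C a : MvPolynomial σ R)) := by
  rw [map_C]
  exact (IsUnit.mk0 _ (by simpa using ha)).map C

variable [IsDomain R]

variable (K) in
/-- Clearing denominators in `K[{X_α}]`. -/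
theorem exists_map_eq_C_mul (k : MvPolynomial σ K) : ∃ a : R, a ≠ 0 ∧
    ∃ h : MvPolynomial σ R, map (algebraMap R K) h = map (algebraMap R K) (C a) * k := by
  let := algebraMvPolynomial (σ := σ) (R := R) (S := K)
  obtain ⟨⟨h, ⟨_, a, ha, rfl⟩⟩, hk⟩ :=
    IsLocalization.surj (R⁰.map (C : R →+* MvPolynomial σ R)) k
  exact ⟨a, nonZeroDivisors.ne_zero ha, h, by rw [mul_comm]; exact hk.symm⟩

/-- Divisibility over `K` is divisibility over `R` up to a nonzero constant. -/
theorem exists_dvd_C_mul_of_map_dvd {f h : MvPolynomial σ R}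
    (hfh : map (algebraMap R K) f ∣ map (algebraMap R K) h) :
    ∃ a : R, a ≠ 0 ∧ f ∣ C a * h := by
  obtain ⟨k, hk⟩ := hfh
  obtain ⟨a, ha, k', hk'⟩ := exists_map_eq_C_mul (R := R) K k
  refine ⟨a, ha, k', map_algebraMap_injective K ?_⟩
  rw [map_mul, map_mul, hk, hk']
  ring

/-- The extension `Q K[{X_α}]` is a prime ideal which contracts to `Q` and has the height
of `Q`. -/
theorem IsUpperToZero.isPrime_map_and_comap_map_and_height_map {Q : Ideal (MvPolynomial σ R)}
    (hQ : IsUpperToZero Q) :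
    (Q.map (map (algebraMap R K))).IsPrime ∧
      (Q.map (map (algebraMap R K))).comap (map (algebraMap R K)) = Q ∧
      (Q.map (map (algebraMap R K))).height = Q.height := by
  let := algebraMvPolynomial (σ := σ) (R := R) (S := K)
  have := hQ.1
  have hdisj : Disjoint ((R⁰.map (C : R →+* MvPolynomial σ R) :
      Submonoid (MvPolynomial σ R)) : Set (MvPolynomial σ R)) Q := by
    rw [Set.disjoint_left]
    rintro _ ⟨a, ha, rfl⟩ h
    exact hQ.C_notMem (nonZeroDivisors.ne_zero ha) h
  exact ⟨IsLocalization.isPrime_of_isPrime_disjoint _ (MvPolynomial σ K) Q hQ.1 hdisj,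
    IsLocalization.under_map_of_isPrime_disjoint _ (MvPolynomial σ K) hQ.1 hdisj,
    IsLocalization.height_map_of_disjoint _ Q hdisj⟩

/-- A nonzero upper to zero contains a polynomial that is prime over `K`, because `K[{X_α}]` is a
unique factorization domain. -/
theorem IsUpperToZero.exists_mem_prime {Q : Ideal (MvPolynomial σ R)} (hQ : IsUpperToZero Q)
    (hQ0 : Q ≠ ⊥) : ∃ f ∈ Q, Prime (map (algebraMap R K) f) := by
  obtain ⟨hprime, hcomap, -⟩ := hQ.isPrime_map_and_comap_map_and_height_map (K := K)
  have hne : Q.map (map (algebraMap R K)) ≠ ⊥ := by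
    intro h
    exact hQ0 ((Ideal.map_eq_bot_iff_of_injective (map_algebraMap_injective K)).mp h)
  obtain ⟨p, hp, hpp⟩ := hprime.exists_mem_prime_of_ne_bot hne
  obtain ⟨a, ha, f, hf⟩ := exists_map_eq_C_mul (R := R) K p
  refine ⟨f, ?_, ?_⟩
  · rw [← hcomap, Ideal.mem_comap, hf]
    exact Ideal.mul_mem_left _ _ hp
  · rw [hf]
    exact (associated_unit_mul_left p _ (isUnit_map_C ha)).symm.prime hpp

/-- An upper to zero of height one is the contraction of a principal prime of `K[{X_α}]`. -/
theorem IsUpperToZero.exists_isIrreducibleGenerator {Q : Ideal (MvPolynomial σ R)}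
    (hQ : IsUpperToZero Q) (hht : Q.height = 1) : ∃ f, IsIrreducibleGenerator K Q f := by
  obtain ⟨hprime, hcomap, hheight⟩ := hQ.isPrime_map_and_comap_map_and_height_map (K := K)
  obtain ⟨f, hfQ, hf⟩ := hQ.exists_mem_prime (K := K) (Ideal.ne_bot_of_height_eq_one hht)
  refine ⟨f, hf.irreducible, ?_⟩
  rw [← Ideal.eq_span_singleton_of_height_eq_one (hheight.trans hht)
    (Ideal.mem_map_of_mem _ hfQ) hf, hcomap]

end Upper

end MvPolynomial

theorem Ideal.height_span_singleton_eq_one_of_prime {A : Type*} [CommRing A] [IsDomain A]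
    [UniqueFactorizationMonoid A] {p : A} (hp : Prime p) : (Ideal.span {p}).height = 1 := by
  have hprime : (Ideal.span {p}).IsPrime := (Ideal.span_singleton_prime hp.ne_zero).mpr hp
  refine le_antisymm ?_ ?_
  · refine Ideal.height_le_iff.mpr fun q hq hlt => ?_
    have hq0 : q = ⊥ := by
      by_contra hq0
      obtain ⟨x, hxq, hx⟩ := hq.exists_mem_prime_of_ne_bot hq0
      have hpx : p ∣ x := Ideal.mem_span_singleton.mp (hlt.le hxq)
      have hxp : x ∣ p := (hp.associated_of_dvd hx hpx).symm.dvd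
      exact hlt.not_ge ((Ideal.span_singleton_le_iff_mem q).mpr (q.mem_of_dvd hxp hxq))
    simp [hq0]
  · rw [Order.one_le_iff_ne_zero, Ne, Ideal.height_eq_zero_iff_eq_bot, Ideal.span_singleton_eq_bot]
    exact hp.ne_zero

theorem MvPolynomial.IsIrreducibleGenerator.height_eq_one {σ R : Type*} [CommRing R] [IsDomain R]
    {K : Type*} [Field K] [Algebra R K] [IsFractionRing R K] {Q : Ideal (MvPolynomial σ R)}
    {f : MvPolynomial σ R} (hf : IsIrreducibleGenerator K Q f) : Q.height = 1 := by
  let := algebraMvPolynomial (σ := σ) (R := R) (S := K)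
  rw [hf.2, ← Ideal.height_span_singleton_eq_one_of_prime hf.1.prime]
  exact IsLocalization.height_under (R⁰.map (C : R →+* MvPolynomial σ R))
    (Ideal.span {map (algebraMap R K) f})

/-! ### Maximal `t`-ideals among the uppers to zero -/

namespace MvPolynomial

variable {σ R : Type*} [CommRing R] [IsDomain R] {K : Type*} [Field K] [Algebra R K]
  [IsFractionRing R K] {L : Type*} [Field L] [Algebra (MvPolynomial σ R) L]
  [IsFractionRing (MvPolynomial σ R) L]

/-- `c(Q)_t = R` means that some member of `Q` has content with `v`-closure `R`. -/
theorem tClosure_contentOfIdeal_eq_one_iff [Nonempty σ] {Q : Ideal (MvPolynomial σ R)}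
    (hQ0 : Q ≠ ⊥) :
    (contentOfIdeal Q : FractionalIdeal R⁰ K).tClosure = 1 ↔
      ∃ g ∈ Q, (g.contentIdeal : FractionalIdeal R⁰ K).vClosure = 1 := by
  rw [show (contentOfIdeal Q : FractionalIdeal R⁰ K).tClosure = 1 ↔
    (1 : K) ∈ (contentOfIdeal Q : FractionalIdeal R⁰ K).tClosure from
      ⟨fun h => h ▸ FractionalIdeal.one_mem_one R⁰,
        FractionalIdeal.eq_one_of_le_one_of_one_mem
          (FractionalIdeal.tClosure_le_one FractionalIdeal.coeIdeal_le_one)⟩,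
    FractionalIdeal.mem_tClosure_coeIdeal_iff (contentOfIdeal_ne_bot hQ0)]
  constructor
  · rintro ⟨J, -, hJQ, hJ, h1⟩
    obtain ⟨g, hg, hle⟩ := exists_mem_le_contentIdeal hJ hJQ
    exact ⟨g, hg, FractionalIdeal.eq_one_of_le_one_of_one_mem
      (FractionalIdeal.vClosure_le_one FractionalIdeal.coeIdeal_le_one)
      (FractionalIdeal.vClosure_mono ((FractionalIdeal.coeIdeal_le_coeIdeal K).mpr hle) h1)⟩
  · rintro ⟨g, hg, h1⟩
    exact ⟨contentIdeal g, contentIdeal_ne_bot (ne_zero_of_vClosure_contentIdeal_eq_one h1),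
      contentIdeal_le_contentOfIdeal hg, contentIdeal_fg g, h1 ▸ FractionalIdeal.one_mem_one R⁰⟩

variable (K L) in
/-- If `I` is a nonzero ideal of `R`, then the polynomials with coefficients in `I_t` form a
`t`-ideal of `R[{X_α}]`. -/
theorem isTIdeal_of_forall_mem_iff {I : Ideal R} (hI : I ≠ ⊥) {N : Ideal (MvPolynomial σ R)}
    (hN : ∀ p, p ∈ N ↔ ∀ m, algebraMap R K (coeff m p) ∈ (I : FractionalIdeal R⁰ K).tClosure) :
    (N : FractionalIdeal (MvPolynomial σ R)⁰ L).IsTIdeal := by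
  classical
  have hN0 : N ≠ ⊥ := by
    obtain ⟨a, haI, ha0⟩ := Submodule.exists_mem_ne_zero_of_ne_bot hI
    have : C a ∈ N := (hN _).mpr fun m => by
      rw [coeff_C]
      split_ifs
      · exact FractionalIdeal.le_tClosure _ (FractionalIdeal.mem_coeIdeal_of_mem R⁰ haI)
      · rw [map_zero]
        exact Submodule.zero_mem (I : FractionalIdeal R⁰ K).tClosure.coeToSubmodule
    exact fun h => ha0 (by simpa [h] using this)
  refine ⟨FractionalIdeal.coeIdeal_ne_zero.mpr hN0,
    le_antisymm ?_ (FractionalIdeal.le_tClosure _)⟩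
  intro x hx
  obtain ⟨p, rfl⟩ := (FractionalIdeal.mem_one_iff _).mp
    (FractionalIdeal.tClosure_le_one FractionalIdeal.coeIdeal_le_one hx)
  obtain ⟨J, hJ0, hJN, ⟨S, rfl⟩, hp⟩ := (FractionalIdeal.mem_tClosure_coeIdeal_iff hN0).mp hx
  -- one finitely generated `B ⊆ I` serves the finitely many coefficients of the generators of `J`
  have hB : ∀ T : Finset R,
      (∀ a ∈ T, algebraMap R K a ∈ (I : FractionalIdeal R⁰ K).tClosure) →
      ∃ B : Ideal R, B ≠ ⊥ ∧ B ≤ I ∧ B.FG ∧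
        ∀ a ∈ T, algebraMap R K a ∈ (B : FractionalIdeal R⁰ K).vClosure := by
    intro T
    induction T using Finset.induction_on with
    | empty =>
      obtain ⟨B, h1, h2, h3, -⟩ := (FractionalIdeal.mem_tClosure_coeIdeal_iff (L := K) hI).mp
        (Submodule.zero_mem (I : FractionalIdeal R⁰ K).tClosure.coeToSubmodule)
      exact fun _ => ⟨B, h1, h2, h3, by simp⟩
    | insert a T _ ih =>
      intro h
      obtain ⟨B, hB0, hBI, hBfg, hBT⟩ := ih fun x hx => h x (Finset.mem_insert_of_mem hx)
      obtain ⟨B', -, hB'I, hB'fg, ha⟩ := (FractionalIdeal.mem_tClosure_coeIdeal_iff hI).mp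
        (h a (Finset.mem_insert_self a T))
      refine ⟨B ⊔ B', fun h0 => hB0 (sup_eq_bot_iff.mp h0).1, sup_le hBI hB'I,
        Submodule.FG.sup hBfg hB'fg, fun x hx => ?_⟩
      rcases Finset.mem_insert.mp hx with rfl | hx
      · exact FractionalIdeal.vClosure_mono
          ((FractionalIdeal.coeIdeal_le_coeIdeal K).mpr le_sup_right) ha
      · exact FractionalIdeal.vClosure_mono
          ((FractionalIdeal.coeIdeal_le_coeIdeal K).mpr le_sup_left) (hBT x hx)
  obtain ⟨B, hB0, hBI, hBfg, hBS⟩ := hB (S.biUnion fun q => q.support.image fun m => coeff m q) (by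
    intro a ha
    obtain ⟨q, hq, ha⟩ := Finset.mem_biUnion.mp ha
    obtain ⟨m, -, rfl⟩ := Finset.mem_image.mp ha
    exact (hN q).mp (hJN (Submodule.subset_span hq)) m)
  refine FractionalIdeal.mem_coeIdeal_of_mem _ ((hN p).mpr fun m => ?_)
  refine (FractionalIdeal.mem_tClosure_coeIdeal_iff hI).mpr ⟨B, hB0, hBI, hBfg, ?_⟩
  refine (FractionalIdeal.algebraMap_mem_vClosure_iff hB0).mpr fun r s hs hrs => ?_
  have hC : C s ∣ C r * p := by
    refine (FractionalIdeal.algebraMap_mem_vClosure_iff hJ0).mp hp (C r) (C s) (by simpa using hs)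
      fun j hj => ?_
    induction hj using Submodule.span_induction with
    | mem q hq =>
      refine C_dvd_iff_dvd_coeff _ _ |>.mpr fun n => ?_
      rw [coeff_C_mul]
      by_cases hn : n ∈ q.support
      · exact (FractionalIdeal.algebraMap_mem_vClosure_iff hB0).mp
          (hBS _ (Finset.mem_biUnion.mpr ⟨q, hq, Finset.mem_image_of_mem _ hn⟩)) r s hs hrs
      · rw [notMem_support_iff.mp hn, mul_zero]
        exact dvd_zero s
    | zero => simp
    | add b c _ _ hb hc =>
      rw [mul_add]
      exact dvd_add hb hc
    | smul c b _ hb =>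
      rw [smul_eq_mul, mul_left_comm]
      exact hb.mul_left c
  have := (C_dvd_iff_dvd_coeff _ _).mp hC m
  rwa [coeff_C_mul] at this

/-- If `c(Q)_t ≠ R`, then the polynomials with coefficients in `c(Q)_t` form a proper `t`-ideal that
contains `Q` and nonzero constants, so that `Q` is not a maximal `t`-ideal. -/
theorem IsUpperToZero.tClosure_contentOfIdeal_eq_one {Q : Ideal (MvPolynomial σ R)}
    (hQ : IsUpperToZero Q) (hmax : Q.IsMaximalTIdeal L) :
    (contentOfIdeal Q : FractionalIdeal R⁰ K).tClosure = 1 := by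
  have hQ0 : Q ≠ ⊥ := FractionalIdeal.coeIdeal_ne_zero.mp hmax.prop.2.1
  have hI := contentOfIdeal_ne_bot hQ0
  set c := (contentOfIdeal Q : FractionalIdeal R⁰ K).tClosure with hc
  have hc1 : c ≤ 1 := FractionalIdeal.tClosure_le_one FractionalIdeal.coeIdeal_le_one
  obtain ⟨P, hP⟩ := FractionalIdeal.le_one_iff_exists_coeIdeal.mp hc1
  by_contra hne
  have hmemP : ∀ a : R, a ∈ P ↔ algebraMap R K a ∈ c := by
    intro a
    rw [← hP]
    refine ⟨FractionalIdeal.mem_coeIdeal_of_mem R⁰, fun h => ?_⟩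
    obtain ⟨b, hb, hba⟩ := (FractionalIdeal.mem_coeIdeal R⁰).mp h
    rwa [← IsFractionRing.injective R K hba]
  have hN : ∀ p : MvPolynomial σ R, p ∈ P.map C ↔ ∀ m, algebraMap R K (coeff m p) ∈ c := by
    intro p
    rw [mem_map_C_iff]
    exact forall_congr' fun m => hmemP _
  have hcQ : ∀ a ∈ contentOfIdeal Q, a ∈ P := fun a ha =>
    (hmemP a).mpr (FractionalIdeal.le_tClosure _ (FractionalIdeal.mem_coeIdeal_of_mem R⁰ ha))
  have hNtop : P.map (C : R →+* MvPolynomial σ R) ≠ ⊤ := by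
    intro h
    have h1 := (hN 1).mp (h ▸ Submodule.mem_top) 0
    rw [coeff_zero_one, map_one] at h1
    exact hne (FractionalIdeal.eq_one_of_le_one_of_one_mem hc1 h1)
  have hQN : Q ≤ P.map C := fun p hp =>
    mem_map_C_iff.mpr fun m => hcQ _ (coeff_mem_contentOfIdeal hp m)
  have hNQ : P.map C ≤ Q := hmax.le_of_ge ⟨hNtop, isTIdeal_of_forall_mem_iff K L hI hN⟩ hQN
  obtain ⟨a, ha, ha0⟩ := Submodule.exists_mem_ne_zero_of_ne_bot hI
  exact hQ.C_notMem ha0 (hNQ (Ideal.mem_map_of_mem _ (hcQ a ha)))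

/-- If `f, h` are coprime over `K` and `c(g)_v = R`, then `(f, h, g)_v = R[{X_α}]`: a fraction
carrying `f` and `h` into `R[{X_α}]` is a polynomial over `K`. -/
theorem dvd_of_isRelPrime {f g h r s : MvPolynomial σ R} (hs : s ≠ 0)
    (hg : (g.contentIdeal : FractionalIdeal R⁰ K).vClosure = 1)
    (hfh : IsRelPrime (map (algebraMap R K) f) (map (algebraMap R K) h))
    (hf0 : f ≠ 0) (hrf : s ∣ r * f) (hrh : s ∣ r * h) (hrg : s ∣ r * g) : s ∣ r := by
  have hs' : map (algebraMap R K) s ≠ 0 := by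
    simpa using (map_algebraMap_injective K).ne hs
  have hf' : map (algebraMap R K) f ≠ 0 := by
    simpa using (map_algebraMap_injective K).ne hf0
  obtain ⟨x, hx⟩ := hrf
  obtain ⟨y, hy⟩ := hrh
  have hxy : x * h = y * f := mul_left_cancel₀ hs (by linear_combination f * hy - h * hx)
  have hfx : map (algebraMap R K) f ∣ map (algebraMap R K) x := by
    refine hfh.dvd_of_dvd_mul_right ?_
    rw [← map_mul, hxy, map_mul]
    exact dvd_mul_left _ _
  have hsr : map (algebraMap R K) s ∣ map (algebraMap R K) r := by
    obtain ⟨z, hz⟩ := hfx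
    refine ⟨z, mul_right_cancel₀ hf' ?_⟩
    rw [← map_mul, hx, map_mul, hz]
    ring
  obtain ⟨a, ha, hsa⟩ := exists_dvd_C_mul_of_map_dvd hsr
  exact dvd_of_dvd_mul_C_of_dvd_mul hg ha hs (by rwa [mul_comm]) hrg

/-- No two nonzero members of a maximal `t`-ideal `Q` are coprime over `K`, so that `Q K[{X_α}]` is
generated by any one of its prime elements. -/
theorem IsUpperToZero.exists_isIrreducibleGenerator_of_isMaximalTIdeal
    {Q : Ideal (MvPolynomial σ R)} (hQ : IsUpperToZero Q) (hmax : Q.IsMaximalTIdeal L)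
    {g : MvPolynomial σ R} (hgQ : g ∈ Q)
    (hg : (g.contentIdeal : FractionalIdeal R⁰ K).vClosure = 1) :
    ∃ f, IsIrreducibleGenerator K Q f := by
  have hQ0 : Q ≠ ⊥ := FractionalIdeal.coeIdeal_ne_zero.mp hmax.prop.2.1
  obtain ⟨hprime, hcomap, -⟩ := hQ.isPrime_map_and_comap_map_and_height_map (K := K)
  obtain ⟨f, hfQ, hf⟩ := hQ.exists_mem_prime (K := K) hQ0
  have hf0 : f ≠ 0 := fun h => hf.ne_zero (by rw [h, map_zero])
  refine ⟨f, hf.irreducible, ?_⟩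
  have hspan : Q.map (map (algebraMap R K)) = Ideal.span {map (algebraMap R K) f} := by
    refine le_antisymm (Ideal.map_le_iff_le_comap.mpr fun h hhQ => ?_)
      ((Ideal.span_singleton_le_iff_mem _).mpr (Ideal.mem_map_of_mem _ hfQ))
    rw [Ideal.mem_comap, Ideal.mem_span_singleton]
    by_contra hndvd
    have hrel := hf.irreducible.isRelPrime_iff_not_dvd.mpr hndvd
    have hne : Ideal.span {f, h, g} ≠ ⊥ := fun h0 =>
      hf0 (Ideal.span_eq_bot.mp h0 f (by simp))
    refine hmax.prop.1 (FractionalIdeal.IsTIdeal.eq_top hmax.prop.2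
      (J := Ideal.span {f, h, g}) ?_ (Submodule.fg_span (Set.toFinite _)) ?_)
    · refine Ideal.span_le.mpr ?_
      rintro x (rfl | rfl | rfl) <;> assumption
    · refine (FractionalIdeal.vClosure_coeIdeal_eq_one_iff hne).mpr fun r s hs hrs => ?_
      exact dvd_of_isRelPrime hs hg hrel hf0 (hrs f (Ideal.subset_span (by simp)))
        (hrs h (Ideal.subset_span (by simp))) (hrs g (Ideal.subset_span (by simp)))
  rw [← hspan, hcomap]

/-! ### The ideal generated by an irreducible generator and a polynomial of unit content -/

/-- A fraction carrying `f` and `g` into `R[{X_α}]` carries all of `Q = f K[{X_α}] ∩ R[{X_α}]`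
into `R[{X_α}]`. -/
theorem IsIrreducibleGenerator.dvd_mul_of_mem {Q : Ideal (MvPolynomial σ R)}
    {f g : MvPolynomial σ R} (hf : IsIrreducibleGenerator K Q f)
    (hg : (g.contentIdeal : FractionalIdeal R⁰ K).vClosure = 1) {r s x : MvPolynomial σ R}
    (hs : s ≠ 0) (hrf : s ∣ r * f) (hrg : s ∣ r * g) (hx : x ∈ Q) : s ∣ r * x := by
  obtain ⟨a, ha, k, hk⟩ := exists_dvd_C_mul_of_map_dvd (hf.mem_iff.mp hx)
  refine dvd_of_dvd_mul_C_of_dvd_mul hg ha hs ?_ ?_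
  · rw [mul_assoc, mul_comm x, hk, ← mul_assoc]
    exact hrf.mul_right k
  · rw [mul_right_comm]
    exact hrg.mul_right x

/-- `Q = (f, g)_v`. If `a g ∈ f R[{X_α}]` with `a` a nonzero constant, then `a / f` carries `f` and `g`
into `R[{X_α}]`, so that `f` divides every member of `(f, g)_v` over `K`. -/
theorem IsIrreducibleGenerator.coeIdeal_eq_vClosure {Q : Ideal (MvPolynomial σ R)}
    {f g : MvPolynomial σ R} (hf : IsIrreducibleGenerator K Q f) (hgQ : g ∈ Q)
    (hg : (g.contentIdeal : FractionalIdeal R⁰ K).vClosure = 1) :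
    (Q : FractionalIdeal (MvPolynomial σ R)⁰ L) =
      ((Ideal.span {f, g} : Ideal (MvPolynomial σ R)) :
        FractionalIdeal (MvPolynomial σ R)⁰ L).vClosure := by
  have hne : Ideal.span {f, g} ≠ ⊥ := fun h0 => hf.ne_zero (Ideal.span_eq_bot.mp h0 f (by simp))
  refine le_antisymm ?_ fun y hy => ?_
  · intro y hy
    obtain ⟨x, hx, rfl⟩ := (FractionalIdeal.mem_coeIdeal _).mp hy
    refine (FractionalIdeal.algebraMap_mem_vClosure_iff hne).mpr fun r s hs hrs => ?_
    exact hf.dvd_mul_of_mem hg hs (hrs f (Ideal.subset_span (by simp)))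
      (hrs g (Ideal.subset_span (by simp))) hx
  · obtain ⟨x, rfl⟩ := (FractionalIdeal.mem_one_iff _).mp
      (FractionalIdeal.vClosure_le_one FractionalIdeal.coeIdeal_le_one hy)
    obtain ⟨a, ha, hag⟩ := exists_dvd_C_mul_of_map_dvd (hf.mem_iff.mp hgQ)
    -- the fraction `a / f` carries `f` and `g` into `R[{X_α}]`
    have hfx : f ∣ C a * x := by
      refine (FractionalIdeal.algebraMap_mem_vClosure_iff hne).mp hy (C a) f hf.ne_zero
        fun j hj => ?_
      obtain ⟨u, v, rfl⟩ := Ideal.mem_span_pair.mp hj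
      rw [mul_add]
      refine dvd_add (Dvd.intro_left (C a * u) (by ring)) ?_
      rw [mul_left_comm]
      exact hag.mul_left v
    refine FractionalIdeal.mem_coeIdeal_of_mem _ (hf.mem_iff.mpr ?_)
    have := map_dvd (map (algebraMap R K)) hfx
    rw [map_mul] at this
    exact (isUnit_map_C ha).dvd_mul_left.mp this

theorem IsIrreducibleGenerator.isTIdeal {Q : Ideal (MvPolynomial σ R)}
    {f g : MvPolynomial σ R} (hf : IsIrreducibleGenerator K Q f) (hgQ : g ∈ Q)
    (hg : (g.contentIdeal : FractionalIdeal R⁰ K).vClosure = 1) :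
    (Q : FractionalIdeal (MvPolynomial σ R)⁰ L).IsTIdeal := by
  have hQ0 : Q ≠ ⊥ := fun h => hf.ne_zero (by simpa [h] using hf.mem)
  have hfg : Ideal.span {f, g} ≤ Q := by
    refine Ideal.span_le.mpr ?_
    rintro x (rfl | rfl)
    exacts [hf.mem, hgQ]
  refine ⟨FractionalIdeal.coeIdeal_ne_zero.mpr hQ0,
    le_antisymm ?_ (FractionalIdeal.le_tClosure _)⟩
  have hne : Ideal.span {f, g} ≠ ⊥ := fun h0 => hf.ne_zero (Ideal.span_eq_bot.mp h0 f (by simp))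
  -- `Q_t ⊆ Q_v`, and `Q_v ⊆ (f, g)_v` because every fraction carrying `f, g` into `R[{X_α}]` also
  -- carries `Q` there
  intro y hy
  have hyv := FractionalIdeal.tClosure_le_vClosure _ hy
  obtain ⟨x, rfl⟩ := (FractionalIdeal.mem_one_iff _).mp
    (FractionalIdeal.vClosure_le_one FractionalIdeal.coeIdeal_le_one hyv)
  rw [hf.coeIdeal_eq_vClosure hgQ hg]
  refine (FractionalIdeal.algebraMap_mem_vClosure_iff hne).mpr fun r s hs hrs => ?_
  exact (FractionalIdeal.algebraMap_mem_vClosure_iff hQ0).mp hyv r s hs fun j hj =>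
    hf.dvd_mul_of_mem hg hs (hrs f (Ideal.subset_span (by simp)))
      (hrs g (Ideal.subset_span (by simp))) hj

/-- With `a g ∈ f R[{X_α}]` for a nonzero constant `a`, the fraction `a / f` lies in `Q⁻¹`; hence
`Q Q⁻¹` contains both `a` and `g`, and `(a, g)_v = R[{X_α}]`. -/
theorem IsIrreducibleGenerator.isTInvertible {Q : Ideal (MvPolynomial σ R)}
    {f g : MvPolynomial σ R} (hf : IsIrreducibleGenerator K Q f) (hgQ : g ∈ Q)
    (hg : (g.contentIdeal : FractionalIdeal R⁰ K).vClosure = 1) :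
    (Q : FractionalIdeal (MvPolynomial σ R)⁰ L).IsTInvertible := by
  have hQ0 : Q ≠ ⊥ := fun h => hf.ne_zero (by simpa [h] using hf.mem)
  set q := (Q : FractionalIdeal (MvPolynomial σ R)⁰ L) with hq
  have hq0 : q ≠ 0 := FractionalIdeal.coeIdeal_ne_zero.mpr hQ0
  obtain ⟨a, ha, hag⟩ := exists_dvd_C_mul_of_map_dvd (hf.mem_iff.mp hgQ)
  have hCa : (C a : MvPolynomial σ R) ≠ 0 := by simpa using ha
  have hfL : algebraMap (MvPolynomial σ R) L f ≠ 0 := by simpa using hf.ne_zero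
  have hinv : algebraMap (MvPolynomial σ R) L (C a) / algebraMap (MvPolynomial σ R) L f ∈ q⁻¹ := by
    refine (FractionalIdeal.mem_inv_iff hq0).mpr fun y hy => ?_
    obtain ⟨x, hx, rfl⟩ := (FractionalIdeal.mem_coeIdeal _).mp hy
    obtain ⟨z, hz⟩ := hf.dvd_mul_of_mem hg hf.ne_zero (dvd_mul_left f (C a)) hag hx
    refine (FractionalIdeal.mem_one_iff _).mpr ⟨z, ?_⟩
    have := congrArg (algebraMap (MvPolynomial σ R) L) hz
    rw [map_mul, map_mul] at this
    field_simp
    rw [this, mul_comm]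
  have hle : q * q⁻¹ ≤ 1 := FractionalIdeal.mul_one_div_le_one
  have haq : algebraMap (MvPolynomial σ R) L (C a) ∈ q * q⁻¹ := by
    rw [← mul_div_cancel₀ (algebraMap (MvPolynomial σ R) L (C a)) hfL]
    exact FractionalIdeal.mul_mem_mul (FractionalIdeal.mem_coeIdeal_of_mem _ hf.mem) hinv
  have hgq : algebraMap (MvPolynomial σ R) L g ∈ q * q⁻¹ :=
    FractionalIdeal.coe_ideal_le_self_mul_inv L Q (FractionalIdeal.mem_coeIdeal_of_mem _ hgQ)
  have hne : Ideal.span {C a, g} ≠ ⊥ := fun h0 => hCa (Ideal.span_eq_bot.mp h0 _ (by simp))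
  refine FractionalIdeal.eq_one_of_le_one_of_one_mem (FractionalIdeal.tClosure_le_one hle)
    (FractionalIdeal.mem_tClosure.mpr ⟨(Ideal.span {C a, g} : Ideal (MvPolynomial σ R)), ?_,
      (FractionalIdeal.coeIdeal_fg _ (IsFractionRing.injective _ L) _).mpr
        (Submodule.fg_span (Set.toFinite _)), ?_⟩)
  · intro y hy
    obtain ⟨x, hx, rfl⟩ := (FractionalIdeal.mem_coeIdeal _).mp hy
    obtain ⟨u, v, rfl⟩ := Ideal.mem_span_pair.mp hx
    rw [map_add, map_mul, map_mul, ← Algebra.smul_def, ← Algebra.smul_def]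
    exact Submodule.add_mem (q * q⁻¹).coeToSubmodule
      (Submodule.smul_mem (q * q⁻¹).coeToSubmodule u haq)
      (Submodule.smul_mem (q * q⁻¹).coeToSubmodule v hgq)
  · rw [(FractionalIdeal.vClosure_coeIdeal_eq_one_iff hne).mpr fun r s hs hrs =>
      dvd_of_dvd_mul_C_of_dvd_mul hg ha hs (hrs _ (Ideal.subset_span (by simp)))
        (hrs _ (Ideal.subset_span (by simp)))]
    exact FractionalIdeal.one_mem_one _

end MvPolynomial

theorem theorem3p3 {R : Type*} [CommRing R] [IsDomain R] {σ : Type*}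
    (K : Type*) [Field K] [Algebra R K] [IsFractionRing R K]
    (L : Type*) [Field L] [Algebra (MvPolynomial σ R) L] [IsFractionRing (MvPolynomial σ R) L]
    (Q : Ideal (MvPolynomial σ R)) (hQ : MvPolynomial.IsUpperToZero Q) :
    List.TFAE
      [Q.IsMaximalTIdeal L,
       (Q : FractionalIdeal (MvPolynomial σ R)⁰ L).IsTIdeal ∧
         (Q : FractionalIdeal (MvPolynomial σ R)⁰ L).IsTInvertible,
       (MvPolynomial.contentOfIdeal Q : FractionalIdeal R⁰ K).tClosure = 1 ∧ Q.height = 1] ∧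
    (Q.IsMaximalTIdeal L →
      (∃ f : MvPolynomial σ R, MvPolynomial.IsIrreducibleGenerator K Q f) ∧
      (∃ g ∈ Q, (g.contentIdeal : FractionalIdeal R⁰ K).vClosure = 1) ∧
      (∀ f g : MvPolynomial σ R, MvPolynomial.IsIrreducibleGenerator K Q f → g ∈ Q →
        (g.contentIdeal : FractionalIdeal R⁰ K).vClosure = 1 →
        (Q : FractionalIdeal (MvPolynomial σ R)⁰ L) =
          ((Ideal.span {f, g} : Ideal (MvPolynomial σ R)) :
            FractionalIdeal (MvPolynomial σ R)⁰ L).vClosure)) := by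

  have gen_of_max : Q.IsMaximalTIdeal L →
      (MvPolynomial.contentOfIdeal Q : FractionalIdeal R⁰ K).tClosure = 1 ∧
      (∃ f, MvPolynomial.IsIrreducibleGenerator K Q f) ∧
      ∃ g ∈ Q, (g.contentIdeal : FractionalIdeal R⁰ K).vClosure = 1 := by
    intro hmax
    have hQ0 : Q ≠ ⊥ := FractionalIdeal.coeIdeal_ne_zero.mp hmax.prop.2.1
    have := hQ.nonempty hQ0
    have hc := hQ.tClosure_contentOfIdeal_eq_one (K := K) hmax
    obtain ⟨g, hgQ, hg⟩ := (MvPolynomial.tClosure_contentOfIdeal_eq_one_iff hQ0).mp hc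
    exact ⟨hc, hQ.exists_isIrreducibleGenerator_of_isMaximalTIdeal hmax hgQ hg, g, hgQ, hg⟩
  refine ⟨?_, fun hmax => ?_⟩
  · tfae_have 1 → 3 := by
      intro hmax
      obtain ⟨hc, ⟨f, hf⟩, -⟩ := gen_of_max hmax
      exact ⟨hc, hf.height_eq_one⟩
    tfae_have 3 → 2 := by
      rintro ⟨hc, hht⟩
      have hQ0 := Ideal.ne_bot_of_height_eq_one hht
      have := hQ.nonempty hQ0
      obtain ⟨g, hgQ, hg⟩ := (MvPolynomial.tClosure_contentOfIdeal_eq_one_iff hQ0).mp hc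
      obtain ⟨f, hf⟩ := hQ.exists_isIrreducibleGenerator (K := K) hht
      exact ⟨hf.isTIdeal hgQ hg, hf.isTInvertible hgQ hg⟩
    tfae_have 2 → 1 := fun ⟨ht, hinv⟩ => hQ.1.isMaximalTIdeal_of_isTInvertible ht hinv
    tfae_finish
  · obtain ⟨-, hf, hg⟩ := gen_of_max hmax
    exact ⟨hf, hg, fun f g hf hgQ hg => hf.coeIdeal_eq_vClosure hgQ hg⟩
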